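/- Let $\mathbb T$ be the unit circle and $\mathbb D$ the open unit disc in $\mathbb C$. Let $\{a_k\}_{k=0}^\infty$ be any sequence of points of $\mathbb D$ (repetitions allowed), and let $\varphi=\{\varphi_k\}_{k\in\mathbb Z}$ be the (extended) Takenaka–Malmquist system it generates, $$\varphi_k(t)=\frac{\sqrt{1-|a_k|^2}}{1-t\overline{a_k}}\prod_{j=0}^{k-1}\frac{t-a_j}{1-t\overline{a_j}}\quad(k\ge 0),\qquad \varphi_{-k}(t)=\overline{t\,\varphi_{k-1}(t)}\quad(k\ge 1),\qquad t\in\mathbb T.$$ For $f\in C(\mathbb T)$ (complex-valued) put $\sigma_{0,\varphi}(f)=f$ and, for $n\ge 1$ and $x\in\mathbb R$, $$\sigma_{n,\varphi}(f)(e^{ix})=\frac{1}{4\pi\gamma_n(x)}\int_{-\pi}^{\pi}f(e^{iy})\,\frac{\sin^2\left(\int_x^y\gamma_n(t)\,dt\right)}{\sin^2\frac{y-x}{2}}\,dy,\qquad \gamma_n(t)=\frac12\sum_{k=0}^{n-1}\frac{1-|a_k|^2}{1-2|a_k|\cos(t-\arg a_k)+|a_k|^2}$$ (the right-hand side depends only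 on $e^{ix}$). Then the following are equivalent: 1. for every $f\in C(\mathbb T)$, $\sigma_{n,\varphi}(f)$ converges to $f$ uniformly on $\mathbb T$ as $n\to\infty$; 2. for every $t\in\mathbb T$, $$\sum_{k=0}^{\infty}\frac{1-|a_k|^2}{|1-t\,\overline{a_k}|^2}=+\infty.$$ -/

import Mathlib

open scoped ComplexConjugate

noncomputable section

/-- A Takenaka–Malmquist system `φ`, given by the sequence of points `a₀, a₁, a₂, …` of the open
unit disc that generates it (repetitions allowed). The functions of the system are
`TakenakaMalmquist.fn`; they determine the points. -/
structure TakenakaMalmquist where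
  /-- The generating points `aₖ`. -/
  points : ℕ → Complex.UnitDisc

namespace TakenakaMalmquist

/-- The point `aₖ`, as a complex number. -/
def a (φ : TakenakaMalmquist) (k : ℕ) : ℂ := (φ.points k : ℂ)

/-- The finite Blaschke product `B_k(z) = ∏_{j < k} (z - a_j) / (1 - z conj(a_j))`. -/
def blaschke (φ : TakenakaMalmquist) (k : ℕ) (z : ℂ) : ℂ :=
  ∏ j ∈ Finset.range k, (z - φ.a j) / (1 - z * conj (φ.a j))

/-- The functions of the extended system on the unit circle:
`φ_k(t) = √(1 - |a_k|²) / (1 - t conj(a_k)) * B_k(t)` for `k ≥ 0`, and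
`φ_{-(k+1)}(t) = conj (t φ_k(t))` for `k ≥ 0`. -/
def fn (φ : TakenakaMalmquist) : ℤ → Circle → ℂ
  | Int.ofNat k, t =>
      (Real.sqrt (1 - ‖φ.a k‖ ^ 2) : ℂ) / (1 - (t : ℂ) * conj (φ.a k)) * φ.blaschke k t
  | Int.negSucc k, t =>
      conj ((t : ℂ) * ((Real.sqrt (1 - ‖φ.a k‖ ^ 2) : ℂ) / (1 - (t : ℂ) * conj (φ.a k))
        * φ.blaschke k t))

/-- `γ_n(t) = ½ ∑_{k < n} (1 - |a_k|²) / (1 - 2 |a_k| cos (t - arg a_k) + |a_k|²)`. -/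
def gamma (φ : TakenakaMalmquist) (n : ℕ) (t : ℝ) : ℝ :=
  (1 / 2) * ∑ k ∈ Finset.range n,
    (1 - ‖φ.a k‖ ^ 2) /
      (1 - 2 * ‖φ.a k‖ * Real.cos (t - Complex.arg (φ.a k)) + ‖φ.a k‖ ^ 2)

/-- The Fejér-type mean at the point `exp (i x)`, as a function of the real variable `x`:
`f (exp (i x))` for `n = 0`, and for `n ≥ 1`
`1 / (4 π γ_n(x)) ∫_{-π}^{π} f(exp (i y)) sin² (∫_x^y γ_n) / sin² ((y - x) / 2) dy`. -/
def sigmaReal (φ : TakenakaMalmquist) (n : ℕ) (f : Circle → ℂ) (x : ℝ) : ℂ :=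
  if n = 0 then f (Circle.exp x)
  else ((1 / (4 * Real.pi * φ.gamma n x) : ℝ) : ℂ) *
    ∫ y in (-Real.pi)..Real.pi, f (Circle.exp y) *
      ((Real.sin (∫ t in x..y, φ.gamma n t) ^ 2 / Real.sin ((y - x) / 2) ^ 2 : ℝ) : ℂ)

/-- The Fejér-type operator `σ_{n,φ}`, as an operator on functions on the unit circle. By
`sigma_exp`, its value at `exp (i x)` is given by the defining formula for every real `x`, so
that the choice of the argument is immaterial. -/
def sigma (φ : TakenakaMalmquist) (n : ℕ) (f : Circle → ℂ) (z : Circle) : ℂ :=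
  φ.sigmaReal n f (Complex.arg z)

theorem kernel_eq (w : ℂ) (t : ℝ) :
    (1 - ‖w‖ ^ 2) / (1 - 2 * ‖w‖ * Real.cos (t - Complex.arg w) + ‖w‖ ^ 2)
      = poissonKernel 0 w (circleMap 0 1 t) := by
  have h : ‖circleMap 0 1 t - w‖ ^ 2
      = 1 - 2 * ‖w‖ * Real.cos (t - Complex.arg w) + ‖w‖ ^ 2 := by
    have hw1 := Complex.norm_mul_cos_arg w
    have hw2 := Complex.norm_mul_sin_arg w
    have h0 : Complex.normSq w = w.re * w.re + w.im * w.im := Complex.normSq_apply w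
    rw [Complex.normSq_eq_norm_sq] at h0
    rw [← Complex.normSq_eq_norm_sq, Complex.normSq_apply, Real.cos_sub]
    simp only [circleMap, Complex.ofReal_one, one_mul, zero_add, Complex.sub_re, Complex.sub_im,
      Complex.exp_ofReal_mul_I_re, Complex.exp_ofReal_mul_I_im]
    have hs := Real.sin_sq_add_cos_sq t
    linear_combination (-2 * Real.cos t) * (-hw1) - (2 * Real.sin t) * (-hw2) + hs - h0
  rw [poissonKernel_def]
  simp [h]

theorem continuous_gamma (φ : TakenakaMalmquist) (n : ℕ) : Continuous (φ.gamma n) := by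
  unfold gamma
  refine continuous_const.mul (continuous_finsetSum _ fun k _ => ?_)
  refine Continuous.div (by fun_prop) (by fun_prop) fun t => ne_of_gt ?_
  have h1 : ‖φ.a k‖ < 1 := (φ.points k).norm_lt_one
  nlinarith [Real.cos_le_one (t - Complex.arg (φ.a k)), norm_nonneg (φ.a k)]

theorem periodic_gamma (φ : TakenakaMalmquist) (n : ℕ) :
    Function.Periodic (φ.gamma n) (2 * Real.pi) := by
  intro t
  simp only [gamma]
  congr 1
  refine Finset.sum_congr rfl fun k _ => ?_
  rw [show t + 2 * Real.pi - Complex.arg (φ.a k) = (t - Complex.arg (φ.a k)) + 2 * Real.pi by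
    ring, Real.cos_add_two_pi]

theorem integral_gamma (φ : TakenakaMalmquist) (n : ℕ) :
    ∫ t in (0 : ℝ)..2 * Real.pi, φ.gamma n t = n * Real.pi := by
  have hk : ∀ k, ∫ t in (0 : ℝ)..2 * Real.pi, poissonKernel 0 (φ.a k) (circleMap 0 1 t)
      = 2 * Real.pi := by
    intro k
    have hmem : φ.a k ∈ Metric.ball (0 : ℂ) 1 := by
      simpa [a] using (φ.points k).norm_lt_one
    have h := DiffContOnCl.circleAverage_poissonKernel_smul (E := ℂ)
      (diffContOnCl_const (c := (1 : ℂ))) hmem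
    rw [Real.circleAverage_def] at h
    simp only [Pi.smul_apply', Complex.real_smul, mul_one] at h
    rw [intervalIntegral.integral_ofReal, ← Complex.ofReal_mul] at h
    have h2 : (2 * Real.pi)⁻¹ *
        ∫ t in (0 : ℝ)..2 * Real.pi, poissonKernel 0 (φ.a k) (circleMap 0 1 t) = 1 := by
      exact_mod_cast h
    have hpi := Real.pi_pos
    field_simp at h2
    linarith
  have hint : ∀ k, IntervalIntegrable
      (fun t => poissonKernel 0 (φ.a k) (circleMap 0 1 t)) MeasureTheory.volume 0
        (2 * Real.pi) := by
    intro k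
    by_contra hc
    have := hk k
    rw [intervalIntegral.integral_undef hc] at this
    have hpi := Real.pi_pos
    linarith
  simp only [gamma, kernel_eq]
  rw [intervalIntegral.integral_const_mul,
    intervalIntegral.integral_finsetSum fun k _ => hint k]
  simp only [hk, Finset.sum_const, Finset.card_range, nsmul_eq_mul]
  ring

theorem sigmaReal_add_int_mul (φ : TakenakaMalmquist) (n : ℕ) (f : Circle → ℂ) (x : ℝ) (m : ℤ) :
    φ.sigmaReal n f (x + m * (2 * Real.pi)) = φ.sigmaReal n f x := by
  have hexp : Circle.exp (x + m * (2 * Real.pi)) = Circle.exp x :=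
    Circle.exp_eq_exp.2 ⟨m, rfl⟩
  have hg : φ.gamma n (x + m * (2 * Real.pi)) = φ.gamma n x :=
    (φ.periodic_gamma n).int_mul m x
  have hii : ∀ u v, IntervalIntegrable (φ.gamma n) MeasureTheory.volume u v := fun u v =>
    (φ.continuous_gamma n).intervalIntegrable u v
  have hint : ∫ t in x..x + m * (2 * Real.pi), φ.gamma n t = ((m * n : ℤ) : ℝ) * Real.pi := by
    have h := (φ.periodic_gamma n).intervalIntegral_add_zsmul_eq m x hii
    rw [(φ.periodic_gamma n).intervalIntegral_add_eq x 0, zero_add, integral_gamma,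
      zsmul_eq_mul, zsmul_eq_mul] at h
    rw [h]
    push_cast
    ring
  have hsin : ∀ (u : ℝ) (j : ℤ), Real.sin (u - j * Real.pi) ^ 2 = Real.sin u ^ 2 := by
    intro u j
    rw [Real.sin_sub_int_mul_pi, mul_pow, ← zpow_natCast ((-1 : ℝ) ^ j) 2, ← zpow_mul]
    rw [Even.neg_one_zpow (by simp), one_mul]
  simp only [sigmaReal, hexp, hg]
  congr 3
  ext y
  congr 3
  · have h := intervalIntegral.integral_interval_sub_left (hii x y) (hii x (x + m * (2 * Real.pi)))
    rw [← h, hint, hsin]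
  · rw [show (y - (x + m * (2 * Real.pi))) / 2 = (y - x) / 2 - m * Real.pi by ring, hsin]

theorem sigma_exp (φ : TakenakaMalmquist) (n : ℕ) (f : Circle → ℂ) (x : ℝ) :
    φ.sigma n f (Circle.exp x) = φ.sigmaReal n f x := by
  obtain ⟨m, hm⟩ := Circle.exp_eq_exp.1 (Circle.exp_arg (Circle.exp x))
  rw [sigma, hm, sigmaReal_add_int_mul]

end TakenakaMalmquist

end

/-! On the circle `2 * γ_n` is the derivative of the argument of the Blaschke product `B_n`, so the
kernel of the mean at `t = exp (i x)` is `|B_n(z) - B_n(t)|² / |z - t|²`. It is nonnegative with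
total mass `4 π γ_n(x)` (`integral_kernel`, from the `L²` norm of the slope of `B_n` in
`exists_blaschke_slope`). Multiplying it by `|z - t|²` cancels the denominator, and the mean value
property gives the second moment `4 π (1 - r)` with `r = Re (conj (B_n(t)) B_n(0))` and `|r| ≤ |a_0|
< 1`.

Hence the mean of `|z - t|²` at `t` is `(1 - r) / γ_n(x)`, comparable to `1 / γ_n(x)` uniformly in
`n ≥ 1` and `x`. Convergence for this one test function forces `γ_n(x) → ∞`. Conversely, a
Korovkin-type estimate (`norm_sigma_sub_le`) bounds the error for any continuous function by `ε + 2
C / γ_n(x)`, and compactness makes the divergence of `γ_n` uniform. The series in question has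
partial sums `2 * γ_n`. -/

/-! ### Mean values and Blaschke factors on the unit circle. -/

theorem circleAverage_re_of_differentiableAt {F : ℂ → ℂ}
    (hF : ∀ z, ‖z‖ ≤ 1 → DifferentiableAt ℂ F z) :
    Real.circleAverage (fun z => (F z).re) 0 1 = (F 0).re := by
  have hd : DiffContOnCl ℂ F (Metric.ball 0 |1|) := by
    refine DifferentiableOn.diffContOnCl fun z hz => (hF z ?_).differentiableWithinAt
    have := Metric.closure_ball_subset_closedBall hz
    simpa using this
  have hi : CircleIntegrable F 0 1 := by
    refine ContinuousOn.circleIntegrable zero_le_one fun z hz => ?_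
    exact (hF z (by simpa using (mem_sphere_iff_norm.1 hz).le)).continuousAt.continuousWithinAt
  have h := Complex.reCLM.circleAverage_comp_comm hi
  rw [hd.circleAverage] at h
  exact h

theorem circleIntegrable_of_continuousAt {E : Type*} [NormedAddCommGroup E] {F : ℂ → E}
    (hF : ∀ z, ‖z‖ = 1 → ContinuousAt F z) : CircleIntegrable F 0 1 :=
  ContinuousOn.circleIntegrable zero_le_one fun z hz =>
    (hF z (by simpa using hz)).continuousWithinAt

theorem one_sub_mul_conj_ne_zero {w z : ℂ} (hw : ‖w‖ < 1) (hz : ‖z‖ ≤ 1) :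
    1 - z * conj w ≠ 0 := by
  intro h
  have h1 : ‖z * conj w‖ = 1 := by rw [← sub_eq_zero.1 h, norm_one]
  rw [norm_mul, RCLike.norm_conj] at h1
  nlinarith [norm_nonneg w, norm_nonneg z]

theorem mul_conj_of_norm_eq_one {z : ℂ} (hz : ‖z‖ = 1) : z * conj z = 1 := by
  rw [Complex.mul_conj, Complex.normSq_eq_norm_sq, hz]; simp

theorem sub_ne_zero_of_norm {w z : ℂ} (hw : ‖w‖ < 1) (hz : ‖z‖ = 1) : z - w ≠ 0 := by
  intro h
  rw [sub_eq_zero.1 h] at hz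
  linarith

/-- Taking the conjugate of a Blaschke factor on the unit circle inverts it. -/
theorem conj_one_sub_mul_conj {w z : ℂ} (hz : ‖z‖ = 1) :
    z * conj (1 - z * conj w) = z - w := by
  have h := mul_conj_of_norm_eq_one hz
  simp only [map_sub, map_one, map_mul, Complex.conj_conj]
  linear_combination (-w) * h

theorem norm_one_sub_mul_conj {w z : ℂ} (hz : ‖z‖ = 1) :
    ‖1 - z * conj w‖ = ‖z - w‖ := by
  rw [← conj_one_sub_mul_conj hz, norm_mul, hz, RCLike.norm_conj, one_mul]

theorem norm_blaschkeFactor {w z : ℂ} (hw : ‖w‖ < 1) (hz : ‖z‖ = 1) :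
    ‖(z - w) / (1 - z * conj w)‖ = 1 := by
  rw [norm_div, norm_one_sub_mul_conj hz, div_self]
  exact norm_ne_zero_iff.2 (sub_ne_zero_of_norm hw hz)

/-- As the real part of a function holomorphic on the closed disc, the Poisson kernel can be
averaged by evaluation at `0`. -/
theorem poisson_eq_re {w z : ℂ} (hw : ‖w‖ < 1) (hz : ‖z‖ = 1) :
    (1 - ‖w‖ ^ 2) / ‖1 - z * conj w‖ ^ 2 = ((1 + z * conj w) / (1 - z * conj w)).re := by
  have h0 := one_sub_mul_conj_ne_zero hw hz.le
  have h1 := mul_conj_of_norm_eq_one hz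
  have hn : (‖1 - z * conj w‖ ^ 2 : ℝ) ≠ 0 := by positivity
  have key : (1 + z * conj w) / (1 - z * conj w)
      = ((1 + z * conj w) * conj (1 - z * conj w)) / ((‖1 - z * conj w‖ ^ 2 : ℝ) : ℂ) := by
    rw [← Complex.normSq_eq_norm_sq, ← Complex.mul_conj]
    have h2 : conj (1 - z * conj w) ≠ 0 := (map_ne_zero _).2 h0
    field_simp
  rw [key, Complex.div_ofReal_re]
  congr 1
  have e : ‖w‖ ^ 2 = ‖z * conj w‖ ^ 2 := by rw [norm_mul, hz, RCLike.norm_conj, one_mul]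
  rw [e, ← Complex.normSq_eq_norm_sq, Complex.normSq_apply]
  simp only [Complex.mul_re, Complex.add_re, Complex.add_im, Complex.sub_re, Complex.sub_im,
    Complex.conj_re, Complex.conj_im, Complex.one_re, Complex.one_im]
  ring

/-! ### Finite Blaschke products and their difference quotients. -/

namespace TakenakaMalmquist

variable (φ : TakenakaMalmquist)

theorem norm_a_lt_one (k : ℕ) : ‖φ.a k‖ < 1 := (φ.points k).norm_lt_one

/-- The partial sums of the series of squared absolute values of the system. -/
noncomputable def kernelSum (n : ℕ) (t : ℂ) : ℝ :=
  ∑ k ∈ Finset.range n, (1 - ‖φ.a k‖ ^ 2) / ‖1 - t * conj (φ.a k)‖ ^ 2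

theorem kernelSum_succ (n : ℕ) (t : ℂ) : φ.kernelSum (n + 1) t
    = φ.kernelSum n t + (1 - ‖φ.a n‖ ^ 2) / ‖1 - t * conj (φ.a n)‖ ^ 2 :=
  Finset.sum_range_succ _ _

theorem blaschke_succ (n : ℕ) (z : ℂ) :
    φ.blaschke (n + 1) z = φ.blaschke n z * ((z - φ.a n) / (1 - z * conj (φ.a n))) :=
  Finset.prod_range_succ _ _

theorem norm_blaschke (n : ℕ) {z : ℂ} (hz : ‖z‖ = 1) : ‖φ.blaschke n z‖ = 1 := by
  rw [blaschke, norm_prod]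
  exact Finset.prod_eq_one fun k _ => norm_blaschkeFactor (φ.norm_a_lt_one k) hz

theorem differentiableAt_blaschke (n : ℕ) {z : ℂ} (hz : ‖z‖ ≤ 1) :
    DifferentiableAt ℂ (φ.blaschke n) z := by
  induction n with
  | zero =>
    have : φ.blaschke 0 = fun _ => 1 := by ext; simp [blaschke]
    rw [this]; fun_prop
  | succ n ih =>
    have : φ.blaschke (n + 1)
        = fun z => φ.blaschke n z * ((z - φ.a n) / (1 - z * conj (φ.a n))) := by
      ext z; exact φ.blaschke_succ n z
    rw [this]
    have := one_sub_mul_conj_ne_zero (φ.norm_a_lt_one n) hz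
    fun_prop (disch := assumption)

/-- Only the factor of `a_0` is kept, the others being at most `1`; this keeps `B_n(0)` away from
the unit circle uniformly in `n`. -/
theorem norm_blaschke_zero_le (n : ℕ) (hn : n ≠ 0) : ‖φ.blaschke n 0‖ ≤ ‖φ.a 0‖ := by
  obtain ⟨m, rfl⟩ := Nat.exists_eq_succ_of_ne_zero hn
  rw [blaschke, norm_prod, Finset.prod_range_succ']
  simp only [zero_sub, zero_mul, sub_zero, div_one, norm_neg]
  refine mul_le_of_le_one_left (norm_nonneg _) ?_
  exact Finset.prod_le_one (fun _ _ => norm_nonneg _) fun k _ => (φ.norm_a_lt_one _).le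

/-- The difference quotient of a finite Blaschke product at a point `t` of the unit circle, and
its squared `L²` norm. -/
theorem exists_blaschke_slope {t : ℂ} (ht : ‖t‖ = 1) (n : ℕ) :
    ∃ G W : ℂ → ℂ, (∀ z, ‖z‖ ≤ 1 → DifferentiableAt ℂ G z) ∧
      (∀ z, ‖z‖ ≤ 1 → DifferentiableAt ℂ W z) ∧
      (∀ z, ‖z‖ ≤ 1 → (z - t) * G z = φ.blaschke n z - φ.blaschke n t) ∧
      W 0 = 0 ∧ (∀ z, ‖z‖ = 1 → conj (G z) * φ.blaschke n z = W z) ∧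
      Real.circleAverage (fun z => ‖G z‖ ^ 2) 0 1 = φ.kernelSum n t := by
  induction n with
  | zero =>
    refine ⟨fun _ => 0, fun _ => 0, by simp, by simp, by simp [blaschke], rfl, by simp, ?_⟩
    simpa [kernelSum] using Real.circleAverage_const (0 : ℝ) 0 1
  | succ n ih =>
    obtain ⟨G, W, hG, hW, hGt, hW0, hGW, hav⟩ := ih
    have ha := φ.norm_a_lt_one n
    have hB : ∀ z, ‖z‖ ≤ 1 → DifferentiableAt ℂ (φ.blaschke n) z :=
      fun z hz => φ.differentiableAt_blaschke n hz
    have hB1 : ∀ z, ‖z‖ = 1 → φ.blaschke n z * conj (φ.blaschke n z) = 1 :=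
      fun z hz => mul_conj_of_norm_eq_one (φ.norm_blaschke n hz)
    have hbt := norm_blaschkeFactor ha ht
    have hsucc := φ.blaschke_succ n
    have hks := φ.kernelSum_succ n t
    generalize φ.a n = w at *
    have hden : ∀ z : ℂ, ‖z‖ ≤ 1 → 1 - z * conj w ≠ 0 :=
      fun z hz => one_sub_mul_conj_ne_zero ha hz
    have hdt := hden t ht.le
    set β : ℂ := (t - w) / (1 - t * conj w) with hβ
    set h : ℂ → ℂ := fun z => (1 - w * conj w) / ((1 - z * conj w) * (1 - t * conj w)) with hh
    have hhd : ∀ z, ‖z‖ ≤ 1 → DifferentiableAt ℂ h z := by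
      intro z hz
      have : (1 - z * conj w) * (1 - t * conj w) ≠ 0 := mul_ne_zero (hden z hz) hdt
      simp only [hh]
      fun_prop (disch := assumption)
    set H : ℂ → ℂ := fun z => z * (1 - w * conj w) / ((1 - z * conj w) * conj (1 - t * conj w))
      with hH
    have hcdt : conj (1 - t * conj w) ≠ 0 := (map_ne_zero _).2 hdt
    have hHd : ∀ z, ‖z‖ ≤ 1 → DifferentiableAt ℂ H z := by
      intro z hz
      have : (1 - z * conj w) * conj (1 - t * conj w) ≠ 0 := mul_ne_zero (hden z hz) hcdt
      simp only [hH]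
      fun_prop (disch := assumption)
    have hbd : ∀ z, ‖z‖ ≤ 1 →
        DifferentiableAt ℂ (fun z => (z - w) / (1 - z * conj w)) z := by
      intro z hz
      have := hden z hz
      fun_prop (disch := assumption)
    -- With `b` the new factor and `β = b(t)`, split `B_n(z) b(z) - B_n(t) β` as `β (B_n(z) -
    -- B_n(t)) + B_n(z) (b(z) - β)`; `h` is the slope of `b` and `H` equals `conj h * b` on the
    -- circle.
    refine ⟨fun z => β * G z + φ.blaschke n z * h z,
      fun z => conj β * ((z - w) / (1 - z * conj w)) * W z + H z, ?_, ?_, ?_, ?_, ?_, ?_⟩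
    · exact fun z hz => ((hG z hz).const_mul _).add ((hB z hz).mul (hhd z hz))
    · exact fun z hz => (((hbd z hz).const_mul _).mul (hW z hz)).add (hHd z hz)
    · intro z hz
      have e := hGt z hz
      have hz' := hden z hz
      have e2 : (z - t) * h z = (z - w) / (1 - z * conj w) - β := by
        simp only [hh, hβ]
        field_simp
        ring
      rw [hsucc, hsucc]
      linear_combination β * e + φ.blaschke n z * e2
    · simp [hW0, hH]
    · intro z hz
      have hz' := hden z hz.le
      have e := hGW z hz
      have e1 := hB1 z hz
      have e3 : conj (h z) * ((z - w) / (1 - z * conj w)) = H z := by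
        have hc : conj (1 - z * conj w) ≠ 0 := (map_ne_zero _).2 hz'
        have e4 := conj_one_sub_mul_conj (w := w) hz
        rw [← e4]
        simp only [hh, hH, map_div₀, map_mul]
        rw [show conj (1 - w * conj w) = 1 - w * conj w by simp [mul_comm]]
        generalize conj (1 - z * conj w) = q at hc
        field_simp
      simp only [hsucc, ← e, ← e3, map_add, map_mul]
      linear_combination conj (h z) * ((z - w) / (1 - z * conj w)) * e1
    · have hcont : ∀ {F : ℂ → ℂ}, (∀ z, ‖z‖ ≤ 1 → DifferentiableAt ℂ F z) →
          CircleIntegrable (fun z => (F z).re) 0 1 := fun hF =>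
        circleIntegrable_of_continuousAt fun z hz =>
          Complex.continuous_re.continuousAt.comp (hF z hz.le).continuousAt
      have hGc : CircleIntegrable (fun z => ‖G z‖ ^ 2) 0 1 :=
        circleIntegrable_of_continuousAt fun z hz => (hG z hz.le).continuousAt.norm.pow 2
      set c : ℝ := (1 - ‖w‖ ^ 2) / ‖1 - t * conj w‖ ^ 2 with hc
      -- On the circle `Re F` is the increase of `‖G‖²`: the cross term plus `‖h‖²`. The cross term
      -- averages to zero because `W 0 = 0`, leaving exactly the new summand `c`.
      set F : ℂ → ℂ := fun z => 2 * conj β * W z * h z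
        + c * ((1 + z * conj w) / (1 - z * conj w)) with hF
      have hFd : ∀ z, ‖z‖ ≤ 1 → DifferentiableAt ℂ F z := by
        intro z hz
        have h1 := hden z hz
        have h2 := hW z hz
        have h3 := hhd z hz
        simp only [hF]
        fun_prop (disch := assumption)
      have hF0 : (F 0).re = c := by simp [hF, hW0]
      have key : ∀ z, ‖z‖ = 1 →
          ‖β * G z + φ.blaschke n z * h z‖ ^ 2 = ‖G z‖ ^ 2 + (F z).re := by
        intro z hz
        have e1 : ‖h z‖ ^ 2 = c * ((1 + z * conj w) / (1 - z * conj w)).re := by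
          rw [← poisson_eq_re ha hz, hc]
          simp only [hh]
          have : (1 : ℂ) - w * conj w = ((1 - ‖w‖ ^ 2 : ℝ) : ℂ) := by
            rw [Complex.mul_conj, Complex.normSq_eq_norm_sq]; push_cast; rfl
          rw [norm_div, norm_mul, this, Complex.norm_real, Real.norm_eq_abs, div_pow, sq_abs,
            mul_pow, div_mul_div_comm, sq (1 - ‖w‖ ^ 2), mul_comm (‖1 - z * conj w‖ ^ 2)]
        have hBn : ‖φ.blaschke n z‖ = 1 := by
          have := congrArg norm (hB1 z hz)
          rw [norm_mul, RCLike.norm_conj, norm_one] at this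
          nlinarith [norm_nonneg (φ.blaschke n z)]
        have e2 : (F z).re = 2 * (φ.blaschke n z * h z * conj (β * G z)).re + ‖h z‖ ^ 2 := by
          rw [e1, ← Complex.re_ofReal_mul c, hF]
          simp only [Complex.add_re]
          congr 1
          rw [← hGW z hz, ← Complex.re_ofReal_mul, map_mul]
          congr 1
          push_cast
          ring
        rw [e2, ← Complex.normSq_eq_norm_sq, add_comm (β * G z), Complex.normSq_add,
          Complex.normSq_eq_norm_sq, Complex.normSq_eq_norm_sq, norm_mul, norm_mul, hBn, hbt]
        ring
      rw [Real.circleAverage_congr_sphere (f₂ := fun z => ‖G z‖ ^ 2 + (F z).re)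
        (fun z hz => key z (by simpa using hz)), Real.circleAverage_fun_add hGc (hcont hFd), hav,
        circleAverage_re_of_differentiableAt hFd, hF0, hks]

/-! ### The phase of the Blaschke product. -/

theorem kernelSum_exp (n : ℕ) (x : ℝ) : φ.kernelSum n (Circle.exp x) = 2 * φ.gamma n x := by
  have h (k : ℕ) : (1 - ‖φ.a k‖ ^ 2) / ‖1 - (Circle.exp x : ℂ) * conj (φ.a k)‖ ^ 2
      = poissonKernel 0 (φ.a k) (circleMap 0 1 x) := by
    rw [norm_one_sub_mul_conj (Circle.norm_coe _), poissonKernel_def]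
    simp [circleMap]
  simp only [kernelSum, gamma, kernel_eq, h]
  ring

theorem hasDerivAt_blaschke_exp (n : ℕ) (y : ℝ) :
    HasDerivAt (fun y : ℝ => φ.blaschke n (Circle.exp y))
      (2 * Complex.I * φ.gamma n y * φ.blaschke n (Circle.exp y)) y := by
  have hg (n : ℕ) : 2 * Complex.I * φ.gamma n y = Complex.I * φ.kernelSum n (Circle.exp y) := by
    rw [kernelSum_exp]; push_cast; ring
  rw [hg]
  induction n with
  | zero => simpa [blaschke, kernelSum] using hasDerivAt_const y (1 : ℂ)
  | succ n ih =>
    simp only [blaschke_succ]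
    rw [kernelSum_succ]
    have hw := φ.norm_a_lt_one n
    generalize φ.a n = w at *
    have hz : ‖(Circle.exp y : ℂ)‖ = 1 := Circle.norm_coe _
    have he : HasDerivAt (fun y : ℝ => (Circle.exp y : ℂ)) (Circle.exp y * Complex.I) y := by
      simp only [Circle.coe_exp]
      have := ((Complex.ofRealCLM.hasDerivAt (x := y)).mul_const Complex.I).cexp
      simpa using this
    have hd := one_sub_mul_conj_ne_zero hw hz.le
    have hq := (he.sub_const w).div ((he.mul_const (conj w)).const_sub 1) hd
    refine (ih.mul hq).congr_deriv ?_
    have e4 := conj_one_sub_mul_conj (w := w) hz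
    have hzz := mul_conj_of_norm_eq_one hz
    have hc : conj (1 - (Circle.exp y : ℂ) * conj w) ≠ 0 := (map_ne_zero _).2 hd
    have e5 : (((1 - ‖w‖ ^ 2) / ‖1 - (Circle.exp y : ℂ) * conj w‖ ^ 2 : ℝ) : ℂ)
        = (1 - w * conj w) /
          ((1 - (Circle.exp y : ℂ) * conj w) * conj (1 - (Circle.exp y : ℂ) * conj w)) := by
      rw [Complex.mul_conj, Complex.mul_conj, Complex.normSq_eq_norm_sq,
        Complex.normSq_eq_norm_sq]
      push_cast; rfl
    rw [Complex.ofReal_add, e5]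
    simp only [Pi.div_apply]
    rw [← e4]
    generalize hQ : conj (1 - (Circle.exp y : ℂ) * conj w) = q at *
    -- Eliminating `w` through `q` leaves a purely algebraic identity.
    have hw' : w = (Circle.exp y : ℂ) - Circle.exp y * q := by rw [e4]; ring
    generalize (Circle.exp y : ℂ) = z at *
    field_simp
    rw [hw']
    ring

/-- Both sides solve the same linear differential equation in `y`, with the same value at `y = x`.
-/
theorem blaschke_exp_eq (n : ℕ) (x y : ℝ) :
    φ.blaschke n (Circle.exp y) = φ.blaschke n (Circle.exp x)
      * Complex.exp (Complex.I * ((2 * ∫ t in x..y, φ.gamma n t : ℝ) : ℂ)) := by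
  have hγ (y : ℝ) : HasDerivAt (fun y => ∫ t in x..y, φ.gamma n t) (φ.gamma n y) y :=
    (φ.continuous_gamma n).integral_hasStrictDerivAt x y |>.hasDerivAt
  have hF (y : ℝ) : HasDerivAt (fun y : ℝ => φ.blaschke n (Circle.exp y)
      * Complex.exp (-(Complex.I * ((2 * ∫ t in x..y, φ.gamma n t : ℝ) : ℂ)))) 0 y := by
    have h1 := ((((hγ y).const_mul 2).ofReal_comp.const_mul Complex.I).neg).cexp
    refine ((φ.hasDerivAt_blaschke_exp n y).mul h1).congr_deriv ?_
    push_cast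
    ring
  have h := is_const_of_deriv_eq_zero (fun y => (hF y).differentiableAt)
    (fun y => (hF y).deriv) y x
  simp only [intervalIntegral.integral_same, mul_zero, Complex.ofReal_zero, neg_zero,
    Complex.exp_zero, mul_one] at h
  rw [← h, mul_assoc, ← Complex.exp_add, neg_add_cancel, Complex.exp_zero, mul_one]

theorem norm_blaschke_sub_sq (n : ℕ) (x y : ℝ) :
    ‖φ.blaschke n (Circle.exp y) - φ.blaschke n (Circle.exp x)‖ ^ 2
      = 4 * Real.sin (∫ t in x..y, φ.gamma n t) ^ 2 := by
  rw [φ.blaschke_exp_eq n x y, ← mul_sub_one, norm_mul, φ.norm_blaschke n (Circle.norm_coe _),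
    Complex.norm_exp_I_mul_ofReal_sub_one, one_mul, mul_div_cancel_left₀ _ two_ne_zero,
    Real.norm_eq_abs, sq_abs]
  ring

theorem norm_circle_exp_sub_sq (x y : ℝ) :
    ‖(Circle.exp y : ℂ) - Circle.exp x‖ ^ 2 = 4 * Real.sin ((y - x) / 2) ^ 2 := by
  have h : (Circle.exp y : ℂ)
      = Circle.exp x * Complex.exp (Complex.I * ((y - x : ℝ) : ℂ)) := by
    rw [Circle.coe_exp, Circle.coe_exp, ← Complex.exp_add]
    congr 1
    push_cast
    ring
  rw [h, ← mul_sub_one, norm_mul, Circle.norm_coe, Complex.norm_exp_I_mul_ofReal_sub_one, one_mul,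
    Real.norm_eq_abs, sq_abs]
  ring

/-! ### The kernel: total mass and second moment. -/

/-- The kernel of the Fejér-type mean, in terms of the Blaschke product. -/
theorem sin_sq_div_sin_sq (n : ℕ) (x y : ℝ) :
    Real.sin (∫ t in x..y, φ.gamma n t) ^ 2 / Real.sin ((y - x) / 2) ^ 2
      = ‖φ.blaschke n (Circle.exp y) - φ.blaschke n (Circle.exp x)‖ ^ 2
        / ‖(Circle.exp y : ℂ) - Circle.exp x‖ ^ 2 := by
  rw [norm_blaschke_sub_sq, norm_circle_exp_sub_sq, mul_div_mul_left _ _ four_ne_zero]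

theorem integral_exp_eq_circleAverage (g : ℂ → ℝ) :
    ∫ y in (-Real.pi)..Real.pi, g (Circle.exp y) = 2 * Real.pi * Real.circleAverage g 0 1 := by
  have hp : Function.Periodic (fun y : ℝ => g (Circle.exp y)) (2 * Real.pi) := fun y => by
    simp only [Circle.exp_add, Circle.exp_two_pi, mul_one]
  have h := hp.intervalIntegral_add_eq (-Real.pi) 0
  rw [show -Real.pi + 2 * Real.pi = Real.pi by ring, zero_add] at h
  rw [h, Real.circleAverage_def, smul_eq_mul, mul_inv_cancel_left₀ Real.two_pi_pos.ne']
  simp [circleMap]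

theorem ae_exp_ne (x : ℝ) :
    ∀ᵐ y : ℝ, (Circle.exp y : ℂ) - Circle.exp x ≠ 0 := by
  have hc : (Set.range fun m : ℤ => x + m * (2 * Real.pi)).Countable := Set.countable_range _
  filter_upwards [hc.ae_notMem MeasureTheory.volume] with y hy h
  obtain ⟨m, hm⟩ := Circle.exp_eq_exp.1 (Circle.ext (sub_eq_zero.1 h))
  exact hy ⟨m, hm.symm⟩

/-- The kernel of the Fejér-type mean is integrable, with integral `4 π γ_n(x)`. -/
theorem integral_kernel (n : ℕ) (x : ℝ) :
    IntervalIntegrable (fun y : ℝ => Real.sin (∫ t in x..y, φ.gamma n t) ^ 2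
        / Real.sin ((y - x) / 2) ^ 2) MeasureTheory.volume (-Real.pi) Real.pi ∧
      ∫ y in (-Real.pi)..Real.pi, Real.sin (∫ t in x..y, φ.gamma n t) ^ 2
        / Real.sin ((y - x) / 2) ^ 2 = 4 * Real.pi * φ.gamma n x := by
  obtain ⟨G, -, hG, -, hGt, -, -, hav⟩ :=
    φ.exists_blaschke_slope (Circle.norm_coe (Circle.exp x)) n
  -- Equality may fail where `exp (i y) = exp (i x)`: there the quotient takes the default value `0
  -- / 0 = 0`.
  have hae : ∀ᵐ y : ℝ, ‖G (Circle.exp y)‖ ^ 2 = Real.sin (∫ t in x..y, φ.gamma n t) ^ 2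
      / Real.sin ((y - x) / 2) ^ 2 := by
    filter_upwards [ae_exp_ne x] with y hy
    have hy' := norm_ne_zero_iff.2 hy
    rw [sin_sq_div_sin_sq, ← hGt _ (Circle.norm_coe _).le, norm_mul]
    field_simp
  have hcont : Continuous fun y : ℝ => ‖G (Circle.exp y)‖ ^ 2 := by
    refine (continuous_iff_continuousAt.2 fun y => ?_).norm.pow 2
    have h1 : ContinuousAt (fun y : ℝ => (Circle.exp y : ℂ)) y := by fun_prop
    exact ContinuousAt.comp (f := fun y : ℝ => (Circle.exp y : ℂ))
      (hG _ (Circle.norm_coe _).le).continuousAt h1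
  constructor
  · refine (hcont.intervalIntegrable _ _).congr_ae ?_
    exact MeasureTheory.ae_restrict_of_ae hae
  · rw [← intervalIntegral.integral_congr_ae (hae.mono fun y h _ => h),
      integral_exp_eq_circleAverage (fun z => ‖G z‖ ^ 2), hav, kernelSum_exp]
    ring

theorem gamma_pos (n : ℕ) (hn : n ≠ 0) (x : ℝ) : 0 < φ.gamma n x := by
  refine mul_pos (by norm_num) (Finset.sum_pos (fun k _ => ?_) (by simpa using hn))
  have h1 := φ.norm_a_lt_one k
  have h0 := norm_nonneg (φ.a k)
  have := Real.cos_le_one (x - Complex.arg (φ.a k))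
  refine div_pos (by nlinarith) (by nlinarith [mul_le_mul_of_nonneg_left this h0])

/-- The mean of the function `z ↦ |z - t|²` at the point `t`. -/
theorem integral_kernel_mul_norm_sub_sq (n : ℕ) (x : ℝ) :
    ∫ y in (-Real.pi)..Real.pi, ‖(Circle.exp y : ℂ) - Circle.exp x‖ ^ 2 *
      (Real.sin (∫ t in x..y, φ.gamma n t) ^ 2 / Real.sin ((y - x) / 2) ^ 2)
      = 4 * Real.pi * (1 - (conj (φ.blaschke n (Circle.exp x)) * φ.blaschke n 0).re) := by
  set b := φ.blaschke n (Circle.exp x) with hb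
  have hb1 : ‖b‖ = 1 := φ.norm_blaschke n (Circle.norm_coe _)
  -- On the circle `Re F = |B_n - b|²`, both terms having modulus `1`.
  set F : ℂ → ℂ := fun z => 2 - 2 * (conj b * φ.blaschke n z) with hF
  have hFd : ∀ z, ‖z‖ ≤ 1 → DifferentiableAt ℂ F z := fun z hz =>
    (((φ.differentiableAt_blaschke n hz).const_mul _).const_mul _).const_sub _
  have hre : ∀ z, (F z).re = 2 - 2 * (conj b * φ.blaschke n z).re := fun z => by
    simp only [hF, Complex.sub_re, Complex.re_ofNat, two_mul (conj b * φ.blaschke n z),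
      Complex.add_re]
    ring
  have hae : ∀ y : ℝ, ‖(Circle.exp y : ℂ) - Circle.exp x‖ ^ 2 *
      (Real.sin (∫ t in x..y, φ.gamma n t) ^ 2 / Real.sin ((y - x) / 2) ^ 2)
      = (F (Circle.exp y)).re := by
    intro y
    have e : (F (Circle.exp y)).re = ‖φ.blaschke n (Circle.exp y) - b‖ ^ 2 := by
      rw [← Complex.normSq_eq_norm_sq, Complex.normSq_sub, Complex.normSq_eq_norm_sq,
        Complex.normSq_eq_norm_sq, hb1, φ.norm_blaschke n (Circle.norm_coe _), hre,
        mul_comm (conj b)]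
      norm_num
    rw [e, sin_sq_div_sin_sq]
    by_cases hy : (Circle.exp y : ℂ) = Circle.exp x
    · simp [hy, hb]
    · have := norm_ne_zero_iff.2 (sub_ne_zero.2 hy)
      rw [hb]
      field_simp
  simp_rw [hae]
  rw [integral_exp_eq_circleAverage (fun z => (F z).re), circleAverage_re_of_differentiableAt hFd,
    hre]
  ring

/-- The upper bound gives `1 - r ≥ 1 - |a_0|` for necessity, the lower one `1 - r ≤ 2` for
sufficiency. -/
theorem norm_conj_blaschke_mul_zero_le (n : ℕ) (hn : n ≠ 0) (x : ℝ) :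
    |(conj (φ.blaschke n (Circle.exp x)) * φ.blaschke n 0).re| ≤ ‖φ.a 0‖ := by
  refine (Complex.abs_re_le_norm _).trans ?_
  rw [norm_mul, RCLike.norm_conj, φ.norm_blaschke n (Circle.norm_coe _), one_mul]
  exact φ.norm_blaschke_zero_le n hn

/-! ### Necessity of divergence. -/

/-- If the means converge at `t = exp (i x)` for `f(z) = |z - t|²`, then `γ_n(x) → ∞`. -/
theorem tendsto_gamma_of_tendsto_sigma (x : ℝ)
    (h : Filter.Tendsto (fun n => φ.sigma n
      (fun z => ((‖(z : ℂ) - Circle.exp x‖ ^ 2 : ℝ) : ℂ)) (Circle.exp x)) Filter.atTop (nhds 0)) :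
    Filter.Tendsto (fun n => φ.gamma n x) Filter.atTop Filter.atTop := by
  have hpos : 0 < 1 - ‖φ.a 0‖ := sub_pos.2 (φ.norm_a_lt_one 0)
  -- For `n ≥ 1` the mean on the right is exactly `(1 - r) / γ_n(x)`.
  have hb : ∀ᶠ n in Filter.atTop, ‖(φ.gamma n x)⁻¹‖ ≤ (1 - ‖φ.a 0‖)⁻¹ * ‖φ.sigma n
      (fun z => ((‖(z : ℂ) - Circle.exp x‖ ^ 2 : ℝ) : ℂ)) (Circle.exp x)‖ := by
    filter_upwards [Filter.eventually_ne_atTop 0] with n hn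
    have hg := φ.gamma_pos n hn x
    rw [sigma_exp, sigmaReal, if_neg hn]
    simp only [← Complex.ofReal_mul]
    rw [intervalIntegral.integral_ofReal, ← Complex.ofReal_mul, integral_kernel_mul_norm_sub_sq,
      Complex.norm_real]
    have hle := (abs_le.1 (φ.norm_conj_blaschke_mul_zero_le n hn x)).2
    generalize (conj (φ.blaschke n (Circle.exp x)) * φ.blaschke n 0).re = r at *
    have e : 1 / (4 * Real.pi * φ.gamma n x) * (4 * Real.pi * (1 - r))
        = (φ.gamma n x)⁻¹ * (1 - r) := by
      have := Real.pi_pos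
      field_simp
    rw [e, norm_mul, mul_left_comm]
    refine le_mul_of_one_le_right (norm_nonneg _) ?_
    rw [Real.norm_eq_abs, inv_mul_eq_div, one_le_div hpos]
    exact le_trans (by linarith) (le_abs_self _)
  have h0 : Filter.Tendsto (fun n => (φ.gamma n x)⁻¹) Filter.atTop (nhds 0) := by
    refine squeeze_zero_norm' hb ?_
    simpa using h.norm.const_mul (1 - ‖φ.a 0‖)⁻¹
  have h1 : Filter.Tendsto (fun n => (φ.gamma n x)⁻¹) Filter.atTop (nhdsWithin 0 (Set.Ioi 0)) :=
    tendsto_nhdsWithin_iff.2 ⟨h0, (Filter.eventually_ne_atTop 0).mono fun n hn =>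
      inv_pos.2 (φ.gamma_pos n hn x)⟩
  exact h1.inv_tendsto_nhdsGT_zero.congr fun n => inv_inv _

/-! ### Sufficiency of divergence. -/

/-- The normalised kernel is a probability density, so the bound `hf` may be integrated against it;
the second moment contributes `(1 - r) / γ_n(x) ≤ 2 / γ_n(x)`. -/
theorem norm_sigma_sub_le (n : ℕ) (hn : n ≠ 0) (f : C(Circle, ℂ)) (x ε C : ℝ) (hC : 0 ≤ C)
    (hf : ∀ z : Circle, ‖f z - f (Circle.exp x)‖ ≤ ε + C * ‖(z : ℂ) - Circle.exp x‖ ^ 2) :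
    ‖φ.sigma n f (Circle.exp x) - f (Circle.exp x)‖ ≤ ε + C * (2 / φ.gamma n x) := by
  have hg := φ.gamma_pos n hn x
  obtain ⟨hi, hint⟩ := φ.integral_kernel n x
  have hsq := φ.integral_kernel_mul_norm_sub_sq n x
  have hr := (abs_le.1 (φ.norm_conj_blaschke_mul_zero_le n hn x)).1
  have ha := φ.norm_a_lt_one 0
  rw [sigma_exp, sigmaReal, if_neg hn]
  generalize (conj (φ.blaschke n (Circle.exp x)) * φ.blaschke n 0).re = r at *
  set K : ℝ → ℝ := fun y => Real.sin (∫ t in x..y, φ.gamma n t) ^ 2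
    / Real.sin ((y - x) / 2) ^ 2 with hK
  have hK0 : ∀ y, 0 ≤ K y := fun y => by positivity
  have hc : Continuous fun y : ℝ => f (Circle.exp y) := by fun_prop
  have hiC : IntervalIntegrable (fun y => (K y : ℂ)) MeasureTheory.volume (-Real.pi) Real.pi :=
    ⟨hi.1.ofReal, hi.2.ofReal⟩
  have hfi := hiC.continuousOn_mul hc.continuousOn
  have hpi := Real.pi_pos
  have hsqc : Continuous fun y : ℝ => ‖(Circle.exp y : ℂ) - Circle.exp x‖ ^ 2 := by fun_prop
  have hsqi := hi.continuousOn_mul hsqc.continuousOn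
  have e1 : ((1 / (4 * Real.pi * φ.gamma n x) : ℝ) : ℂ)
        * (∫ y in (-Real.pi)..Real.pi, f (Circle.exp y) * (K y : ℂ)) - f (Circle.exp x)
      = ((1 / (4 * Real.pi * φ.gamma n x) : ℝ) : ℂ)
        * ∫ y in (-Real.pi)..Real.pi, (f (Circle.exp y) - f (Circle.exp x)) * (K y : ℂ) := by
    simp only [sub_mul]
    rw [intervalIntegral.integral_sub hfi (hiC.const_mul _),
      intervalIntegral.integral_const_mul, intervalIntegral.integral_ofReal, hint, mul_sub,
      mul_left_comm _ (f (Circle.exp x)), ← Complex.ofReal_mul, one_div_mul_cancel (by positivity),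
      Complex.ofReal_one, mul_one]
  have e2 : ‖∫ y in (-Real.pi)..Real.pi, (f (Circle.exp y) - f (Circle.exp x)) * (K y : ℂ)‖
      ≤ ∫ y in (-Real.pi)..Real.pi,
        (ε * K y + C * (‖(Circle.exp y : ℂ) - Circle.exp x‖ ^ 2 * K y)) := by
    refine intervalIntegral.norm_integral_le_of_norm_le (by linarith) (.of_forall fun y _ => ?_)
      ((hi.const_mul _).add (hsqi.const_mul _))
    rw [norm_mul, Complex.norm_real, Real.norm_eq_abs, abs_of_nonneg (hK0 y)]
    refine (mul_le_mul_of_nonneg_right (hf _) (hK0 y)).trans_eq (by ring)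
  rw [intervalIntegral.integral_add (hi.const_mul _) (hsqi.const_mul _),
    intervalIntegral.integral_const_mul, intervalIntegral.integral_const_mul, hint, hsq] at e2
  rw [e1, norm_mul, Complex.norm_real, Real.norm_eq_abs, abs_of_pos (by positivity)]
  refine (mul_le_mul_of_nonneg_left e2 (by positivity)).trans ?_
  have e3 : 1 / (4 * Real.pi * φ.gamma n x)
      * (ε * (4 * Real.pi * φ.gamma n x) + C * (4 * Real.pi * (1 - r)))
      = ε + C * ((1 - r) / φ.gamma n x) := by
    field_simp
  rw [e3]
  gcongr
  linarith

theorem continuous_kernelSum (n : ℕ) : Continuous fun t : Circle => φ.kernelSum n t := by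
  refine continuous_finsetSum _ fun k _ => Continuous.div (by fun_prop) (by fun_prop) fun t => ?_
  have := one_sub_mul_conj_ne_zero (φ.norm_a_lt_one k) (Circle.norm_coe t).le
  positivity

theorem monotone_kernelSum (t : ℂ) : Monotone fun n => φ.kernelSum n t := by
  refine monotone_nat_of_le_succ fun n => ?_
  rw [kernelSum_succ]
  have h1 := φ.norm_a_lt_one n
  have : 0 ≤ 1 - ‖φ.a n‖ ^ 2 := by nlinarith [norm_nonneg (φ.a n)]
  have : 0 ≤ (1 - ‖φ.a n‖ ^ 2) / ‖1 - t * conj (φ.a n)‖ ^ 2 := by positivity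
  linarith

/-- By compactness, pointwise divergence of the kernel sums is uniform. -/
theorem exists_lt_kernelSum
    (h : ∀ t : Circle, Filter.Tendsto (fun n => φ.kernelSum n t) Filter.atTop Filter.atTop)
    (M : ℝ) : ∃ N, ∀ n ≥ N, ∀ t : Circle, M < φ.kernelSum n t := by
  have hmono : Monotone fun n => {t : Circle | M < φ.kernelSum n t} :=
    fun m n hmn t ht => lt_of_lt_of_le ht (φ.monotone_kernelSum t hmn)
  obtain ⟨N, hN⟩ := isCompact_univ.elim_directed_cover
    (fun n => {t : Circle | M < φ.kernelSum n t})
    (fun n => isOpen_lt continuous_const (φ.continuous_kernelSum n))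
    (fun t _ => Set.mem_iUnion.2 ((h t).eventually_gt_atTop M).exists)
    hmono.directed_le
  exact ⟨N, fun n hn t => hmono hn (hN (Set.mem_univ t))⟩

end TakenakaMalmquist

/-- A continuous function on the circle has a uniform modulus of continuity of the form
`ε + C |z - w|²`. -/
theorem exists_norm_sub_le_add_mul_sq (f : C(Circle, ℂ)) {ε : ℝ} (hε : 0 < ε) :
    ∃ C, 0 ≤ C ∧ ∀ z w : Circle, ‖f z - f w‖ ≤ ε + C * ‖(z : ℂ) - w‖ ^ 2 := by
  obtain ⟨δ, hδ, h⟩ := Metric.uniformContinuous_iff.1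
    (CompactSpace.uniformContinuous_of_continuous f.continuous) ε hε
  -- At distance at least `δ` the quadratic term already dominates the trivial bound `2 * ‖f‖`.
  refine ⟨2 * ‖f‖ / δ ^ 2, by positivity, fun z w => ?_⟩
  rcases lt_or_ge (dist z w) δ with hzw | hzw
  · have := h hzw
    rw [dist_eq_norm] at this
    have : 0 ≤ 2 * ‖f‖ / δ ^ 2 * ‖(z : ℂ) - w‖ ^ 2 := by positivity
    linarith
  · replace hzw : δ ≤ ‖(z : ℂ) - w‖ := by rwa [← dist_eq_norm]
    have h1 : ‖f z - f w‖ ≤ 2 * ‖f‖ := by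
      linarith [norm_sub_le (f z) (f w), f.norm_coe_le_norm z, f.norm_coe_le_norm w]
    have h2 : 2 * ‖f‖ ≤ 2 * ‖f‖ / δ ^ 2 * ‖(z : ℂ) - w‖ ^ 2 := by
      rw [div_mul_eq_mul_div, le_div_iff₀ (by positivity)]
      gcongr
    linarith

theorem mainTheorem5 (φ : TakenakaMalmquist) :
    (∀ f : C(Circle, ℂ),
      TendstoUniformly (fun (n : ℕ) (z : Circle) => φ.sigma n f z) f Filter.atTop) ↔
    (∀ t : Circle,
      Filter.Tendsto
        (fun n : ℕ => ∑ k ∈ Finset.range n,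
          (1 - ‖φ.a k‖ ^ 2) / ‖1 - (t : ℂ) * conj (φ.a k)‖ ^ 2)
        Filter.atTop Filter.atTop) := by
  constructor
  · intro h t
    obtain ⟨x, rfl⟩ : ∃ x, Circle.exp x = t := ⟨_, Circle.exp_arg t⟩
    change Filter.Tendsto (fun n => φ.kernelSum n (Circle.exp x)) _ _
    simp only [TakenakaMalmquist.kernelSum_exp]
    refine Filter.Tendsto.const_mul_atTop two_pos (φ.tendsto_gamma_of_tendsto_sigma x ?_)
    have := (h ⟨fun z => ((‖(z : ℂ) - Circle.exp x‖ ^ 2 : ℝ) : ℂ), by fun_prop⟩).tendsto_at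
      (Circle.exp x)
    simpa using this
  · intro h f
    rw [Metric.tendstoUniformly_iff]
    intro ε hε
    obtain ⟨C, hC, hf⟩ := exists_norm_sub_le_add_mul_sq f (half_pos hε)
    -- As the kernel sum is `2 * γ_n`, this threshold makes `2 C / γ_n < ε / 2`.
    obtain ⟨N, hN⟩ := φ.exists_lt_kernelSum h (8 * C / ε)
    filter_upwards [Filter.eventually_ge_atTop N, Filter.eventually_ne_atTop 0] with n hn hn0 t
    obtain ⟨x, rfl⟩ : ∃ x, Circle.exp x = t := ⟨_, Circle.exp_arg t⟩
    have h1 := φ.norm_sigma_sub_le n hn0 f x (ε / 2) C hC fun z => hf z _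
    have h2 := hN n hn (Circle.exp x)
    rw [TakenakaMalmquist.kernelSum_exp, div_lt_iff₀ hε] at h2
    have hg := φ.gamma_pos n hn0 x
    rw [dist_comm, dist_eq_norm]
    refine h1.trans_lt ?_
    have : C * (2 / φ.gamma n x) < ε / 2 := by
      rw [← mul_div_assoc, div_lt_iff₀ hg]
      linarith
    linarith
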